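/- For a positive integer $v$ and a set $K$ of positive integers, a $(v,K,1)$ perfect difference family is a finite family $\mathcal F$ of subsets (base blocks) of $\mathbb Z_v=\mathbb Z/v\mathbb Z$ such that (1) $|B|\in K$ for every $B\in\mathcal F$; (2) every nonzero $d\in\mathbb Z_v$ has exactly one representation $d=x-y$ with $x,y\in B$, $x\ne y$, $B\in\mathcal F$; (3) every $B\in\mathcal F$ contains $0$, and every nonzero element of $B$ is the residue class of some integer $a$ with $1\le a\le\lfloor v/2\rfloor$. **Lemma.** For every integer $v\ge 59$ with $v\equiv 5\pmod 6$ there exists a $(v,\{3,4,5\},1)$ perfect difference family. -/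

import Mathlib

/-- `IsCDF v K F`: `F` is (the set of base blocks of) a `(v, K, 1)` cyclic difference family, i.e. a
family of subsets of `ℤ/v` with sizes in `K` such that each nonzero `d` in `ℤ/v` is exactly once
a difference `x - y` of two distinct elements `x, y` of a common block. -/
def IsCDF (v : ℕ) (K : Set ℕ) (F : Finset (Finset (ZMod v))) : Prop :=
  (∀ B ∈ F, B.card ∈ K) ∧
  ∀ d : ZMod v, d ≠ 0 →
    ∃! p : Finset (ZMod v) × ZMod v × ZMod v,
      p.1 ∈ F ∧ p.2.1 ∈ p.1 ∧ p.2.2 ∈ p.1 ∧ p.2.1 ≠ p.2.2 ∧ p.2.1 - p.2.2 = d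

/-- `IsPDF v K F`: `F` is a `(v, K, 1)` perfect difference family, i.e. a cyclic difference family
each of whose base blocks contains `0` and has its other elements among (the residue classes of)
`1, …, ⌊v / 2⌋`. -/
def IsPDF (v : ℕ) (K : Set ℕ) (F : Finset (Finset (ZMod v))) : Prop :=
  IsCDF v K F ∧
  ∀ B ∈ F, (0 : ZMod v) ∈ B ∧
    ∀ b ∈ B, b ≠ 0 → ∃ a : ℕ, 1 ≤ a ∧ a ≤ v / 2 ∧ (a : ZMod v) = b

/-! Write v = 2n + 1, so n ≡ 2 mod 3 and n ≥ 29. It suffices to find blocks in {0, …, n} whose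
positive differences are 1, …, n, each once. A block of size 3, 4 or 5 has 3, 6 or 10 of them, so
the number of blocks of size five must be ≡ 2 mod 3; two are used. For n ≤ 95 the blocks are
tabulated. For larger n = 12t + 96 + r, three nested families of triples (`nestedTriples`) absorb
12t + 24 differences. The other 72 + r lie in windows of length independent of t, whose ends are
affine in t. Blocks with affine entries cover them, by an identity of coefficients that is checked
once for all t (`exists_isPDF_of_isResidualCover`). -/

/-! ### From integer differences to cyclic differences -/

theorem exists_isPDF_of_surjective_differences {ι : Type*} [Fintype ι] {n : ℕ} {K : Set ℕ}
    (B : ι → Finset ℕ) (hK : ∀ i, (B i).card ∈ K) (h0 : ∀ i, 0 ∈ B i)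
    (hle : ∀ i, ∀ b ∈ B i, b ≤ n)
    (hsum : ∑ i, ((B i).card * (B i).card - (B i).card) ≤ 2 * n)
    (hcov : ∀ d, 1 ≤ d → d ≤ n → ∃ i, ∃ x ∈ B i, ∃ y ∈ B i, y + d = x) :
    ∃ F : Finset (Finset (ZMod (2 * n + 1))), IsPDF (2 * n + 1) K F := by
  classical
  have hcast : ∀ i, ∀ x ∈ B i, ∀ y ∈ B i, ((x : ℕ) : ZMod (2 * n + 1)) = y → x = y := by
    intro i x hx y hy h
    have hx' := hle i x hx
    have hy' := hle i y hy
    rwa [ZMod.natCast_eq_natCast_iff', Nat.mod_eq_of_lt (by omega),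
      Nat.mod_eq_of_lt (by omega)] at h
  let g : ι → Finset (ZMod (2 * n + 1)) := fun i => (B i).image (fun x : ℕ => (x : ZMod (2 * n + 1)))
  let S : Finset (Σ _ : ι, ℕ × ℕ) := Finset.univ.sigma fun i => (B i).offDiag
  let f : (Σ _ : ι, ℕ × ℕ) → ZMod (2 * n + 1) := fun p => (p.2.1 : ZMod (2 * n + 1)) - p.2.2
  have hmaps : ∀ p ∈ S, f p ∈ (Finset.univ.erase 0 : Finset (ZMod (2 * n + 1))) := by
    rintro ⟨i, x, y⟩ hp
    simp only [S, Finset.mem_sigma, Finset.mem_offDiag] at hp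
    simp only [f, Finset.mem_erase, Finset.mem_univ, and_true, ne_eq, sub_eq_zero]
    exact fun h => hp.2.2.2 (hcast i x hp.2.1 y hp.2.2.1 h)
  have hsurj : Set.SurjOn f S (Finset.univ.erase 0 : Finset (ZMod (2 * n + 1))) := by
    intro d hd
    have hd0 : d ≠ 0 := by simpa using hd
    have hval : ((d.val : ℕ) : ZMod (2 * n + 1)) = d := ZMod.natCast_zmod_val d
    have hpos : 0 < d.val := ZMod.val_pos.2 hd0
    have hlt : d.val < 2 * n + 1 := ZMod.val_lt d
    by_cases hn : d.val ≤ n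
    · obtain ⟨i, x, hx, y, hy, hxy⟩ := hcov d.val hpos hn
      refine ⟨⟨i, x, y⟩, ?_, ?_⟩
      · simp only [S, Finset.coe_sigma, Set.mem_sigma_iff, Finset.mem_coe, Finset.mem_univ,
          Finset.mem_offDiag, true_and]
        exact ⟨hx, hy, by omega⟩
      · simp only [f, ← hxy, Nat.cast_add, hval, add_sub_cancel_left]
    -- Here -d has its representative in 1, …, n, so a pair for -d is taken in reverse order.
    · obtain ⟨i, x, hx, y, hy, hxy⟩ := hcov (2 * n + 1 - d.val) (by omega) (by omega)
      refine ⟨⟨i, y, x⟩, ?_, ?_⟩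
      · simp only [S, Finset.coe_sigma, Set.mem_sigma_iff, Finset.mem_coe, Finset.mem_univ,
          Finset.mem_offDiag, true_and]
        exact ⟨hy, hx, by omega⟩
      · have h : ((y + (2 * n + 1) : ℕ) : ZMod (2 * n + 1)) = (x + d.val : ℕ) := by
          congr 1; omega
        rw [Nat.cast_add, ZMod.natCast_self, add_zero, Nat.cast_add, hval] at h
        simp only [f, h, add_sub_cancel_left]
  -- At most 2n ordered pairs map onto the 2n nonzero residues, so no residue is hit twice. Coverage
  -- and a count thus replace any check of uniqueness.
  have hinj : Set.InjOn f S := by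
    refine Finset.injOn_of_surjOn_of_card_le f hmaps hsurj ?_
    rw [Finset.card_erase_of_mem (Finset.mem_univ _), Finset.card_univ, ZMod.card]
    simpa [S, Finset.card_sigma, Finset.offDiag_card] using hsum
  refine ⟨Finset.univ.image g, ⟨?_, ?_⟩, ?_⟩
  · intro C hC
    obtain ⟨i, -, rfl⟩ := Finset.mem_image.1 hC
    rw [Finset.card_image_of_injOn fun x hx y hy h => hcast i x hx y hy h]
    exact hK i
  · intro d hd
    obtain ⟨⟨i, x, y⟩, hp, hf⟩ := hsurj (show d ∈ _ by simpa using hd)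
    simp only [S, Finset.coe_sigma, Set.mem_sigma_iff, Finset.mem_coe, Finset.mem_univ,
      Finset.mem_offDiag, true_and] at hp
    refine ⟨(g i, (x : ZMod (2 * n + 1)), (y : ZMod (2 * n + 1))), ?_, ?_⟩
    · refine ⟨Finset.mem_image_of_mem _ (Finset.mem_univ _), Finset.mem_image_of_mem _ hp.1,
        Finset.mem_image_of_mem _ hp.2.1, fun h => hp.2.2 (hcast i x hp.1 y hp.2.1 h), hf⟩
    · rintro ⟨C, a, b⟩ ⟨hC, ha, hb, hab, hsub⟩
      obtain ⟨j, -, rfl⟩ := Finset.mem_image.1 hC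
      obtain ⟨x', hx', rfl⟩ := Finset.mem_image.1 ha
      obtain ⟨y', hy', rfl⟩ := Finset.mem_image.1 hb
      have heq : (⟨j, x', y'⟩ : Σ _ : ι, ℕ × ℕ) = ⟨i, x, y⟩ := by
        refine hinj ?_ ?_ (hsub.trans hf.symm)
        · simp only [S, Finset.coe_sigma, Set.mem_sigma_iff, Finset.mem_coe, Finset.mem_univ,
            Finset.mem_offDiag, true_and]
          exact ⟨hx', hy', fun h => hab (by simp only [h])⟩
        · simp only [S, Finset.coe_sigma, Set.mem_sigma_iff, Finset.mem_coe, Finset.mem_univ,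
            Finset.mem_offDiag, true_and]
          exact hp
      cases heq
      rfl
  · intro C hC
    obtain ⟨i, -, rfl⟩ := Finset.mem_image.1 hC
    refine ⟨Finset.mem_image.2 ⟨0, h0 i, Nat.cast_zero⟩, fun b hb hb0 => ?_⟩
    obtain ⟨x, hx, rfl⟩ := Finset.mem_image.1 hb
    have := hle i x hx
    refine ⟨x, Nat.one_le_iff_ne_zero.2 fun h => hb0 (by simp [h]), by omega, rfl⟩

theorem exists_isPDF_of_lists {n : ℕ} {K : Set ℕ} (L : List (List ℕ))
    (hL : ∀ B ∈ L, B.Pairwise (· < ·) ∧ B.length ∈ K ∧ 0 ∈ B ∧ ∀ b ∈ B, b ≤ n)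
    (hsum : (L.map fun B => B.length * B.length - B.length).sum ≤ 2 * n)
    (hcov : ∀ d, 1 ≤ d → d ≤ n → ∃ B ∈ L, ∃ x ∈ B, ∃ y ∈ B, y + d = x) :
    ∃ F : Finset (Finset (ZMod (2 * n + 1))), IsPDF (2 * n + 1) K F := by
  have hcard : ∀ i : Fin L.length, (L[i]).toFinset.card = (L[i]).length := fun i =>
    List.toFinset_card_of_nodup ((hL _ (List.getElem_mem i.2)).1.imp fun h => ne_of_lt h)
  refine exists_isPDF_of_surjective_differences (fun i : Fin L.length => (L[i]).toFinset)
    (fun i => ?_) (fun i => ?_) (fun i => ?_) ?_ fun d h1 h2 => ?_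
  · rw [hcard]
    exact (hL _ (List.getElem_mem i.2)).2.1
  · exact List.mem_toFinset.2 (hL _ (List.getElem_mem i.2)).2.2.1
  · exact fun b hb => (hL _ (List.getElem_mem i.2)).2.2.2 b (List.mem_toFinset.1 hb)
  · simp only [hcard]
    exact (Fin.sum_univ_fun_getElem L fun B => B.length * B.length - B.length).trans_le hsum
  · obtain ⟨B, hB, x, hx, y, hy, h⟩ := hcov d h1 h2
    obtain ⟨i, hi, rfl⟩ := List.getElem_of_mem hB
    exact ⟨⟨i, hi⟩, x, List.mem_toFinset.2 hx, y, List.mem_toFinset.2 hy, h⟩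

/-- A family of blocks `R` of sizes four and five together with the blocks `{0, a, a + b}` for
`(a, b) ∈ T` gives a perfect difference family. -/
theorem exists_isPDF_of_blocks_of_triples {n : ℕ} (R : List (List ℕ)) (T : List (ℕ × ℕ))
    (hR : ∀ B ∈ R, B.Pairwise (· < ·) ∧ (B.length = 4 ∨ B.length = 5) ∧ 0 ∈ B ∧ ∀ b ∈ B, b ≤ n)
    (hT : ∀ p ∈ T, 0 < p.1 ∧ 0 < p.2 ∧ p.1 + p.2 ≤ n)
    (hsum : (R.map fun B => B.length * B.length - B.length).sum + 6 * T.length ≤ 2 * n)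
    (hcov : ∀ d, 1 ≤ d → d ≤ n → (∃ B ∈ R, ∃ x ∈ B, ∃ y ∈ B, y + d = x) ∨
      ∃ p ∈ T, d = p.1 ∨ d = p.2 ∨ d = p.1 + p.2) :
    ∃ F : Finset (Finset (ZMod (2 * n + 1))), IsPDF (2 * n + 1) {3, 4, 5} F := by
  refine exists_isPDF_of_lists (R ++ T.map fun p => [0, p.1, p.1 + p.2]) (fun B hB => ?_) ?_
    fun d h1 h2 => ?_
  · rcases List.mem_append.1 hB with hB | hB
    · obtain ⟨h1, h2, h3⟩ := hR B hB
      exact ⟨h1, Or.inr h2, h3⟩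
    · obtain ⟨p, hp, rfl⟩ := List.mem_map.1 hB
      obtain ⟨h1, h2, h3⟩ := hT p hp
      refine ⟨by simp; omega, by simp, by simp, ?_⟩
      simp
      omega
  · simpa [Function.comp_def, mul_comm] using hsum
  · rcases hcov d h1 h2 with ⟨B, hB, h⟩ | ⟨p, hp, h⟩
    · exact ⟨B, List.mem_append_left _ hB, h⟩
    · refine ⟨_, List.mem_append_right _ (List.mem_map_of_mem hp), ?_⟩
      rcases h with rfl | rfl | rfl
      · exact ⟨p.1, by simp, 0, by simp, by simp⟩
      · exact ⟨p.1 + p.2, by simp, p.1, by simp, rfl⟩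
      · exact ⟨p.1 + p.2, by simp, 0, by simp, by simp⟩

/-! ### Differences with entries affine in t -/

/-- `d` is a difference of two elements of a block of `R`, or one of the differences of a block
`{0, a, a + b}` with `(a, b) ∈ T`. -/
def IsDifferenceOf {α : Type*} [Add α] (R : List (List α)) (T : List (α × α)) (d : α) : Prop :=
  (∃ B ∈ R, ∃ x ∈ B, ∃ y ∈ B, y + d = x) ∨ ∃ p ∈ T, d = p.1 ∨ d = p.2 ∨ d = p.1 + p.2

instance {α : Type*} [Add α] [DecidableEq α] (R : List (List α)) (T : List (α × α)) :
    DecidablePred (IsDifferenceOf R T) := fun d => by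
  unfold IsDifferenceOf
  infer_instance

/-- The affine function of `t` with slope `p.1` and constant term `p.2`. -/
def affineEval (t : ℕ) (p : ℕ × ℕ) : ℕ := p.1 * t + p.2

theorem affineEval_add (t : ℕ) (p q : ℕ × ℕ) :
    affineEval t (p + q) = affineEval t p + affineEval t q := by
  simp only [affineEval, Prod.fst_add, Prod.snd_add]
  ring

/-- Evaluation at t is additive, so a relation between coefficient pairs holds at every t; this
turns an infinite family of checks into one finite check. -/
theorem IsDifferenceOf.affineEval {R : List (List (ℕ × ℕ))} {T : List ((ℕ × ℕ) × (ℕ × ℕ))}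
    {d : ℕ × ℕ} (h : IsDifferenceOf R T d) (t : ℕ) :
    IsDifferenceOf (R.map (List.map (affineEval t)))
      (T.map (Prod.map (affineEval t) (affineEval t))) (affineEval t d) := by
  rcases h with ⟨B, hB, x, hx, y, hy, rfl⟩ | ⟨p, hp, h⟩
  · exact Or.inl ⟨_, List.mem_map_of_mem hB, _, List.mem_map_of_mem hx, _, List.mem_map_of_mem hy,
      (affineEval_add t y d).symm⟩
  · refine Or.inr ⟨_, List.mem_map_of_mem hp, ?_⟩
    rcases h with rfl | rfl | rfl
    · exact Or.inl rfl
    · exact Or.inr (Or.inl rfl)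
    · exact Or.inr (Or.inr (affineEval_add t _ _))

theorem IsDifferenceOf.append_right {α : Type*} [Add α] {R : List (List α)} {T : List (α × α)}
    {d : α} (h : IsDifferenceOf R T d) (T' : List (α × α)) : IsDifferenceOf R (T ++ T') d :=
  h.imp_right fun ⟨p, hp, h⟩ => ⟨p, List.mem_append_left _ hp, h⟩

/-! ### Nested triples -/

/-- Three nested families of pairs `(a, b)` with `a` and `b` and `a + b` running through intervals
of numbers of constant parity, respectively of consecutive numbers. -/
def nestedTriples (t e o₁ o₂ : ℕ) : List (ℕ × ℕ) :=
  ((List.range (2 * t + 8)).map fun j => (2 * j + 8, 10 * t + 76 + e - j)) ++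
  (((List.range t).map fun j => (2 * j + 9, 6 * t + 44 + o₂ - j)) ++
  ((List.range t).map fun j => (2 * (j + t) + 25, 5 * t + 36 + o₁ - j)))

theorem length_nestedTriples (t e o₁ o₂ : ℕ) :
    (nestedTriples t e o₁ o₂).length = 4 * t + 8 := by
  simp only [nestedTriples, List.length_append, List.length_map, List.length_range]
  omega

theorem mem_nestedTriples {t e o₁ o₂ : ℕ} {p : ℕ × ℕ} :
    p ∈ nestedTriples t e o₁ o₂ ↔
      (∃ j < 2 * t + 8, (2 * j + 8, 10 * t + 76 + e - j) = p) ∨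
      (∃ j < t, (2 * j + 9, 6 * t + 44 + o₂ - j) = p) ∨
      (∃ j < t, (2 * (j + t) + 25, 5 * t + 36 + o₁ - j) = p) := by
  simp only [nestedTriples, List.mem_append, List.mem_map, List.mem_range]

/-- As j grows by 1, a grows by 2 and b drops by 1, so a + b grows by 1. The first three
alternatives are the ranges of a in the three families; then come the ranges of b and a + b, family
by family. -/
theorem nestedTriples_covers {t e o₁ o₂ x : ℕ}
    (h : (x % 2 = 0 ∧ 8 ≤ x ∧ x < 4 * t + 24) ∨
      (x % 2 = 1 ∧ 9 ≤ x ∧ x < 2 * t + 9) ∨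
      (x % 2 = 1 ∧ 2 * t + 25 ≤ x ∧ x < 4 * t + 25) ∨
      (8 * t + 69 + e ≤ x ∧ x < 10 * t + 77 + e) ∨
      (10 * t + 84 + e ≤ x ∧ x < 12 * t + 92 + e) ∨
      (5 * t + 45 + o₂ ≤ x ∧ x < 6 * t + 45 + o₂) ∨
      (6 * t + 53 + o₂ ≤ x ∧ x < 7 * t + 53 + o₂) ∨
      (4 * t + 37 + o₁ ≤ x ∧ x < 5 * t + 37 + o₁) ∨
      (7 * t + 61 + o₁ ≤ x ∧ x < 8 * t + 61 + o₁)) :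
    ∃ p ∈ nestedTriples t e o₁ o₂, x = p.1 ∨ x = p.2 ∨ x = p.1 + p.2 := by
  simp only [mem_nestedTriples]
  rcases h with h | h | h | h | h | h | h | h | h
  · exact ⟨_, Or.inl ⟨(x - 8) / 2, by omega, rfl⟩, Or.inl (by omega)⟩
  · exact ⟨_, Or.inr (Or.inl ⟨(x - 9) / 2, by omega, rfl⟩), Or.inl (by omega)⟩
  · exact ⟨_, Or.inr (Or.inr ⟨(x - 25) / 2 - t, by omega, rfl⟩), Or.inl (by omega)⟩
  · exact ⟨_, Or.inl ⟨10 * t + 76 + e - x, by omega, rfl⟩, Or.inr (Or.inl (by omega))⟩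
  · exact ⟨_, Or.inl ⟨x - (10 * t + 84 + e), by omega, rfl⟩, Or.inr (Or.inr (by omega))⟩
  · exact ⟨_, Or.inr (Or.inl ⟨6 * t + 44 + o₂ - x, by omega, rfl⟩), Or.inr (Or.inl (by omega))⟩
  · exact ⟨_, Or.inr (Or.inl ⟨x - (6 * t + 53 + o₂), by omega, rfl⟩), Or.inr (Or.inr (by omega))⟩
  · exact ⟨_, Or.inr (Or.inr ⟨5 * t + 36 + o₁ - x, by omega, rfl⟩), Or.inr (Or.inl (by omega))⟩
  · exact ⟨_, Or.inr (Or.inr ⟨x - (7 * t + 61 + o₁), by omega, rfl⟩), Or.inr (Or.inr (by omega))⟩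

/-! ### The residual differences -/

/-- The differences in `1, …, 12 * t + 96 + r` outside `nestedTriples t e o₁ o₂`, as affine functions
of `t`: each entry `(a, l, u)` of the list stands for the numbers from `a * t + l` to `a * t + u`. -/
def IsResidualCover (r e o₁ o₂ : ℕ) (R : List (List (ℕ × ℕ)))
    (T : List ((ℕ × ℕ) × (ℕ × ℕ))) : Prop :=
  (∀ j < 8, IsDifferenceOf R T (2, 2 * j + 9)) ∧
  ∀ w ∈ [(0, 1, 7), (4, 24, 36 + o₁), (5, 37 + o₁, 44 + o₂), (6, 45 + o₂, 52 + o₂),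
      (7, 53 + o₂, 60 + o₁), (8, 61 + o₁, 68 + e), (10, 77 + e, 83 + e), (12, 92 + e, 96 + r)],
    ∀ c < w.2.2 + 1, w.2.1 ≤ c → IsDifferenceOf R T (w.1, c)

instance (r e o₁ o₂ : ℕ) (R : List (List (ℕ × ℕ))) (T : List ((ℕ × ℕ) × (ℕ × ℕ))) :
    Decidable (IsResidualCover r e o₁ o₂ R T) := by
  unfold IsResidualCover
  infer_instance

/-- The bounds `hparam` keep the nested triples inside 1, …, n. Comparing coefficients separately in
`hR` and `hT` gives the order and size conditions for every t. -/
theorem exists_isPDF_of_isResidualCover {r e o₁ o₂ : ℕ} (R : List (List (ℕ × ℕ)))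
    (T : List ((ℕ × ℕ) × (ℕ × ℕ)))
    (hparam : e ≤ r + 5 ∧ o₁ ≤ e + 8 ∧ o₂ ≤ e + 8)
    (hR : ∀ B ∈ R, B.Pairwise (fun p q => p.1 ≤ q.1 ∧ p.2 < q.2) ∧
      (B.length = 4 ∨ B.length = 5) ∧ (0, 0) ∈ B ∧ ∀ b ∈ B, b.1 ≤ 12 ∧ b.2 ≤ 96 + r)
    (hT : ∀ p ∈ T, 0 < p.1.2 ∧ 0 < p.2.2 ∧ p.1.1 + p.2.1 ≤ 12 ∧ p.1.2 + p.2.2 ≤ 96 + r)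
    (hsum : (R.map fun B => B.length * B.length - B.length).sum + 6 * T.length ≤ 144 + 2 * r)
    (hcov : IsResidualCover r e o₁ o₂ R T) (t : ℕ) :
    ∃ F : Finset (Finset (ZMod (2 * (12 * t + 96 + r) + 1))),
      IsPDF (2 * (12 * t + 96 + r) + 1) {3, 4, 5} F := by
  have hmono : ∀ {a b : ℕ}, a ≤ b → a * t ≤ b * t := fun h => Nat.mul_le_mul_right t h
  refine exists_isPDF_of_blocks_of_triples (R.map (List.map (affineEval t)))
    (T.map (Prod.map (affineEval t) (affineEval t)) ++ nestedTriples t e o₁ o₂) ?_ ?_ ?_ ?_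
  · intro B' hB'
    obtain ⟨B, hB, rfl⟩ := List.mem_map.1 hB'
    obtain ⟨h1, h2, h3, h4⟩ := hR B hB
    refine ⟨List.pairwise_map.2 (h1.imp fun h => ?_), by simpa using h2,
      List.mem_map.2 ⟨_, h3, by simp [affineEval]⟩, ?_⟩
    · exact add_lt_add_of_le_of_lt (hmono h.1) h.2
    · intro b hb
      obtain ⟨p, hp, rfl⟩ := List.mem_map.1 hb
      have h5 := h4 p hp
      have := hmono h5.1
      simp only [affineEval]
      omega
  · intro p hp
    rcases List.mem_append.1 hp with hp | hp
    · obtain ⟨q, hq, rfl⟩ := List.mem_map.1 hp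
      obtain ⟨h1, h2, h3, h4⟩ := hT q hq
      have := hmono h3
      simp only [Prod.map, affineEval]
      rw [add_mul] at this
      omega
    · rcases mem_nestedTriples.1 hp with ⟨j, hj, rfl⟩ | ⟨j, hj, rfl⟩ | ⟨j, hj, rfl⟩ <;>
        dsimp only <;> omega
  · simp only [List.map_map, Function.comp_def, List.length_map, List.length_append,
      length_nestedTriples]
    omega
  · intro d h1 h2
    have hwin : ∀ a c : ℕ, IsDifferenceOf R T (a, c) → d = a * t + c →
        IsDifferenceOf (R.map (List.map (affineEval t)))
          (T.map (Prod.map (affineEval t) (affineEval t)) ++ nestedTriples t e o₁ o₂) d := by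
      rintro a c h rfl
      exact (h.affineEval t).append_right _
    obtain ⟨hodd, hint⟩ := hcov
    simp only [List.forall_mem_cons, List.not_mem_nil, false_imp_iff, implies_true, and_true]
      at hint
    obtain ⟨i0, i4, i5, i6, i7, i8, i10, i12⟩ := hint
    by_cases hc0 : d < 8
    · exact hwin 0 d (i0 d (by omega) h1) (by omega)
    -- The eight odd numbers between the ranges of a in the second and third families.
    by_cases hc2 : d % 2 = 1 ∧ 2 * t + 9 ≤ d ∧ d < 2 * t + 25
    · exact hwin 2 _ (hodd ((d - 2 * t - 9) / 2) (by omega)) (by omega)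
    by_cases hc4 : 4 * t + 24 ≤ d ∧ d < 4 * t + 37 + o₁
    · exact hwin 4 (d - 4 * t) (i4 _ (by omega) (by omega)) (by omega)
    by_cases hc5 : 5 * t + 37 + o₁ ≤ d ∧ d < 5 * t + 45 + o₂
    · exact hwin 5 (d - 5 * t) (i5 _ (by omega) (by omega)) (by omega)
    by_cases hc6 : 6 * t + 45 + o₂ ≤ d ∧ d < 6 * t + 53 + o₂
    · exact hwin 6 (d - 6 * t) (i6 _ (by omega) (by omega)) (by omega)
    by_cases hc7 : 7 * t + 53 + o₂ ≤ d ∧ d < 7 * t + 61 + o₁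
    · exact hwin 7 (d - 7 * t) (i7 _ (by omega) (by omega)) (by omega)
    by_cases hc8 : 8 * t + 61 + o₁ ≤ d ∧ d < 8 * t + 69 + e
    · exact hwin 8 (d - 8 * t) (i8 _ (by omega) (by omega)) (by omega)
    by_cases hc10 : 10 * t + 77 + e ≤ d ∧ d < 10 * t + 84 + e
    · exact hwin 10 (d - 10 * t) (i10 _ (by omega) (by omega)) (by omega)
    by_cases hc12 : 12 * t + 92 + e ≤ d
    · exact hwin 12 (d - 12 * t) (i12 _ (by omega) (by omega)) (by omega)
    obtain ⟨p, hp, h⟩ := nestedTriples_covers (t := t) (e := e) (o₁ := o₁) (o₂ := o₂) (x := d)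
      (by omega)
    exact Or.inr ⟨p, List.mem_append_right _ hp, h⟩

/-! ### Explicit residual covers for the four classes of n mod 12 -/

/-- Here and below, the shifts `e`, `o₁`, `o₂` of the nested intervals are free parameters, chosen
together with the explicit blocks. -/
theorem exists_isPDF_of_residue_2 (t : ℕ) :
    ∃ F : Finset (Finset (ZMod (2 * (12 * t + 96 + 2) + 1))),
      IsPDF (2 * (12 * t + 96 + 2) + 1) {3, 4, 5} F :=
  exists_isPDF_of_isResidualCover (r := 2) (e := 2) (o₁ := 0) (o₂ := 1)
    [[(0, 0), (0, 2), (0, 5), (4, 33), (8, 69)], [(0, 0), (0, 4), (2, 19), (7, 59), (7, 60)], [(0,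
     0), (0, 6), (8, 68), (10, 85)]]
    [((0, 7), (4, 25)), ((2, 9), (6, 52)), ((2, 11), (5, 43)), ((2, 13), (5, 45)), ((2, 21), (8,
     63)), ((2, 23), (4, 24)), ((4, 26), (8, 70)), ((4, 27), (6, 53)), ((4, 29), (8, 66)), ((4,
     30), (4, 35)), ((4, 34), (6, 49)), ((5, 37), (7, 57)), ((5, 38), (5, 44)), ((5, 39), (5,
     42)), ((6, 46), (6, 51)), ((6, 48), (6, 50))]
    (by decide) (by decide) (by decide) (by decide) (by decide +kernel) t

theorem exists_isPDF_of_residue_5 (t : ℕ) :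
    ∃ F : Finset (Finset (ZMod (2 * (12 * t + 96 + 5) + 1))),
      IsPDF (2 * (12 * t + 96 + 5) + 1) {3, 4, 5} F :=
  exists_isPDF_of_isResidualCover (r := 5) (e := 1) (o₁ := 0) (o₂ := 1)
    [[(0, 0), (0, 5), (0, 6), (4, 32), (12, 99)], [(0, 0), (0, 4), (4, 33), (4, 35), (12, 101)],
     [(0, 0), (7, 57), (7, 60), (12, 100)]]
    [((0, 7), (8, 62)), ((2, 9), (6, 52)), ((2, 11), (5, 45)), ((2, 13), (5, 42)), ((2, 15), (4,
     34)), ((2, 17), (6, 48)), ((2, 19), (8, 64)), ((2, 21), (8, 63)), ((2, 23), (4, 24)), ((4,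
     25), (6, 53)), ((4, 28), (6, 51)), ((4, 30), (6, 50)), ((4, 36), (6, 46)), ((5, 37), (5,
     44)), ((5, 38), (7, 58)), ((5, 39), (7, 59)), ((5, 41), (7, 54))]
    (by decide) (by decide) (by decide) (by decide) (by decide +kernel) t

theorem exists_isPDF_of_residue_8 (t : ℕ) :
    ∃ F : Finset (Finset (ZMod (2 * (12 * t + 96 + 8) + 1))),
      IsPDF (2 * (12 * t + 96 + 8) + 1) {3, 4, 5} F :=
  exists_isPDF_of_isResidualCover (r := 8) (e := 2) (o₁ := 2) (o₂ := 1)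
    [[(0, 0), (0, 2), (0, 6), (12, 102), (12, 103)], [(0, 0), (6, 46), (6, 53), (10, 79), (10,
     84)]]
    [((0, 3), (7, 58)), ((2, 9), (5, 45)), ((2, 11), (8, 70)), ((2, 13), (5, 43)), ((2, 15), (8,
     67)), ((2, 17), (6, 48)), ((2, 19), (6, 49)), ((2, 21), (5, 41)), ((2, 23), (4, 24)), ((4,
     25), (8, 69)), ((4, 27), (4, 36)), ((4, 28), (6, 52)), ((4, 29), (4, 37)), ((4, 30), (4,
     34)), ((4, 32), (6, 51)), ((4, 35), (6, 50)), ((5, 39), (7, 59)), ((5, 40), (7, 55)), ((5,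
     42), (7, 57)), ((5, 44), (7, 60))]
    (by decide) (by decide) (by decide) (by decide) (by decide +kernel) t

theorem exists_isPDF_of_residue_11 (t : ℕ) :
    ∃ F : Finset (Finset (ZMod (2 * (12 * t + 96 + 11) + 1))),
      IsPDF (2 * (12 * t + 96 + 11) + 1) {3, 4, 5} F :=
  exists_isPDF_of_isResidualCover (r := 11) (e := 3) (o₁ := 3) (o₂ := 3)
    [[(0, 0), (7, 57), (7, 60), (7, 61), (12, 104)], [(0, 0), (0, 5), (0, 7), (8, 71), (12, 102)]]
    [((0, 6), (4, 30)), ((2, 9), (2, 15)), ((2, 11), (4, 38)), ((2, 13), (4, 39)), ((2, 17), (5,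
     41)), ((2, 19), (8, 67)), ((2, 21), (10, 80)), ((2, 23), (4, 25)), ((4, 26), (8, 70)), ((4,
     27), (6, 55)), ((4, 28), (6, 53)), ((4, 29), (6, 54)), ((4, 32), (8, 68)), ((4, 33), (6,
     51)), ((4, 34), (8, 65)), ((4, 35), (6, 50)), ((4, 37), (8, 69)), ((5, 40), (7, 63)), ((5,
     42), (7, 56)), ((5, 45), (7, 62)), ((5, 46), (7, 59))]
    (by decide) (by decide) (by decide) (by decide) (by decide +kernel) t

/-! ### Small orders -/

/-- Orders `n`, blocks of sizes four and five, and pairs `(a, b)` standing for blocks `{0, a, a + b}`,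
whose differences are `1, …, n`. -/
def smallFamilies : List (ℕ × List (List ℕ) × List (ℕ × ℕ)) := [
  (29, [[0, 1, 15, 20, 28], [0, 7, 11, 17, 29], [0, 2, 23, 26]],
    [(9, 16)]),
  (32, [[0, 5, 6, 18, 25], [0, 3, 14, 29, 31]],
    [(4, 23), (8, 16), (9, 21), (10, 22)]),
  (35, [[0, 9, 17, 29, 32], [0, 6, 11, 25, 27]],
    [(1, 33), (4, 26), (7, 24), (10, 18), (13, 22)]),
  (38, [[0, 9, 11, 26, 38], [0, 14, 32, 36, 37], [0, 19, 25, 35]],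
    [(3, 30), (7, 24), (8, 20), (13, 21)]),
  (41, [[0, 4, 20, 30, 33], [0, 14, 31, 32, 39], [0, 12, 21, 36]],
    [(2, 35), (5, 23), (6, 34), (11, 27), (19, 22)]),
  (44, [[0, 2, 3, 14, 42], [0, 4, 19, 26, 36]],
    [(5, 30), (6, 31), (8, 25), (9, 29), (13, 21), (16, 27), (18, 23), (20, 24)]),
  (47, [[0, 17, 22, 30, 37], [0, 2, 3, 27, 43]],
    [(4, 34), (6, 26), (9, 36), (10, 29), (11, 31), (12, 35), (14, 19), (18, 28), (21, 23)]),
  (50, [[0, 2, 27, 35, 48], [0, 18, 19, 41, 47], [0, 9, 26, 40]],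
    [(3, 36), (4, 7), (5, 38), (10, 32), (12, 37), (15, 30), (16, 34), (20, 24)]),
  (53, [[0, 7, 23, 24, 51], [0, 4, 18, 38, 47], [0, 39, 42, 52]],
    [(2, 35), (5, 45), (6, 40), (8, 25), (11, 21), (12, 36), (15, 26), (19, 30), (22, 31)]),
  (56, [[0, 36, 47, 50, 56], [0, 13, 30, 32, 48]],
    [(1, 39), (4, 42), (5, 29), (7, 38), (8, 44), (10, 43), (12, 25), (15, 26), (21, 33), (22,
     27), (23, 28), (24, 31)]),
  (59, [[0, 7, 25, 37, 38], [0, 2, 19, 48, 59]],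
    [(3, 55), (4, 28), (5, 22), (6, 44), (8, 43), (9, 36), (10, 42), (14, 39), (15, 26), (16, 33),
     (20, 34), (21, 35), (23, 24)]),
  (62, [[0, 34, 37, 58, 60], [0, 18, 33, 53, 62], [0, 12, 39, 50]],
    [(1, 48), (4, 13), (5, 52), (6, 45), (7, 36), (8, 47), (10, 46), (14, 28), (16, 25), (19, 40),
     (22, 32), (30, 31)]),
  (65, [[0, 5, 9, 44, 47], [0, 28, 45, 60, 61], [0, 12, 46, 53]],
    [(2, 21), (6, 51), (8, 50), (10, 49), (11, 14), (13, 52), (18, 36), (19, 29), (20, 43), (22,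
     40), (24, 31), (26, 30), (27, 37)]),
  (68, [[0, 1, 32, 48, 59], [0, 9, 33, 35, 39]],
    [(3, 46), (5, 62), (7, 54), (8, 36), (10, 53), (12, 52), (13, 42), (14, 29), (15, 51), (17,
     28), (18, 50), (19, 38), (20, 21), (22, 34), (23, 37), (25, 40)]),
  (71, [[0, 16, 20, 42, 56], [0, 28, 30, 51, 69]],
    [(1, 31), (3, 47), (5, 63), (6, 59), (7, 48), (8, 58), (9, 44), (10, 57), (11, 34), (12, 49),
     (13, 25), (15, 37), (17, 54), (19, 43), (24, 46), (27, 33), (29, 35)]),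
  (74, [[0, 51, 68, 70, 71], [0, 18, 25, 48, 61], [0, 35, 50, 72]],
    [(4, 58), (5, 39), (6, 57), (8, 56), (9, 38), (10, 55), (11, 41), (12, 54), (14, 53), (16,
     33), (21, 24), (26, 34), (27, 46), (28, 31), (29, 40), (32, 42)]),
  (77, [[0, 15, 39, 75, 76], [0, 22, 25, 29, 70], [0, 52, 63, 72]],
    [(2, 30), (5, 38), (6, 58), (8, 57), (10, 56), (12, 55), (13, 33), (14, 54), (16, 53), (17,
     27), (18, 31), (19, 40), (21, 50), (23, 51), (26, 47), (28, 34), (35, 42)]),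
  (80, [[0, 21, 41, 44, 78], [0, 1, 50, 55, 80]],
    [(2, 38), (4, 43), (6, 63), (7, 26), (8, 62), (9, 27), (10, 61), (11, 17), (12, 60), (13, 52),
     (14, 59), (15, 51), (16, 58), (18, 46), (19, 48), (22, 53), (24, 32), (29, 39), (31, 45),
     (35, 42)]),
  (83, [[0, 29, 34, 51, 71], [0, 21, 48, 80, 83]],
    [(1, 72), (2, 38), (4, 77), (6, 44), (7, 36), (8, 58), (9, 65), (10, 57), (11, 64), (12, 56),
     (13, 39), (14, 55), (15, 45), (16, 54), (18, 23), (19, 63), (24, 25), (26, 53), (28, 33),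
     (30, 46), (31, 47)]),
  (86, [[0, 30, 33, 57, 85], [0, 11, 31, 70, 72], [0, 1, 46, 82]],
    [(4, 40), (5, 38), (6, 68), (7, 15), (8, 67), (9, 42), (10, 66), (12, 65), (13, 56), (14, 64),
     (16, 63), (17, 32), (18, 62), (19, 34), (21, 50), (23, 35), (25, 48), (26, 60), (29, 54),
     (37, 47)]),
  (89, [[0, 28, 55, 84, 85], [0, 11, 31, 48, 82], [0, 15, 39, 61]],
    [(2, 43), (3, 83), (4, 70), (5, 49), (6, 69), (7, 19), (8, 68), (9, 44), (10, 67), (12, 66),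
     (13, 60), (14, 65), (16, 64), (18, 63), (21, 41), (23, 36), (25, 33), (32, 40), (35, 52),
     (38, 50), (42, 47)]),
  (92, [[0, 19, 26, 46, 47], [0, 11, 55, 64, 68]],
    [(2, 39), (3, 62), (5, 54), (6, 75), (8, 74), (10, 73), (12, 72), (14, 71), (15, 45), (16,
     70), (17, 35), (18, 69), (22, 56), (23, 38), (24, 66), (25, 67), (29, 48), (30, 50), (31,
     32), (33, 58), (34, 42), (36, 43), (37, 51), (40, 49)]),
  (95, [[0, 24, 44, 55, 91], [0, 32, 35, 80, 89]],
    [(1, 4), (2, 79), (6, 52), (7, 68), (8, 74), (10, 73), (12, 72), (13, 53), (14, 71), (15, 41),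
     (16, 70), (17, 61), (18, 69), (19, 76), (21, 29), (22, 27), (23, 37), (25, 40), (26, 64),
     (28, 34), (30, 63), (33, 59), (38, 39), (42, 46), (43, 51)])]

theorem smallFamilies_spec : ∀ s ∈ smallFamilies,
    (∀ B ∈ s.2.1, B.Pairwise (· < ·) ∧ (B.length = 4 ∨ B.length = 5) ∧ 0 ∈ B ∧ ∀ b ∈ B, b ≤ s.1) ∧
    (∀ p ∈ s.2.2, 0 < p.1 ∧ 0 < p.2 ∧ p.1 + p.2 ≤ s.1) ∧
    (s.2.1.map fun B => B.length * B.length - B.length).sum + 6 * s.2.2.length ≤ 2 * s.1 ∧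
    ∀ d < s.1 + 1, 1 ≤ d → IsDifferenceOf s.2.1 s.2.2 d := by
  decide +kernel

theorem exists_isPDF_of_le {n : ℕ} (h1 : 29 ≤ n) (h2 : n ≤ 95) (h3 : n % 3 = 2) :
    ∃ F : Finset (Finset (ZMod (2 * n + 1))), IsPDF (2 * n + 1) {3, 4, 5} F := by
  have hmem : ∀ n < 96, 29 ≤ n → n % 3 = 2 → ∃ s ∈ smallFamilies, s.1 = n := by
    decide +kernel
  obtain ⟨s, hs, rfl⟩ := hmem n (by omega) h1 h3
  obtain ⟨hR, hT, hsum, hcov⟩ := smallFamilies_spec s hs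
  exact exists_isPDF_of_blocks_of_triples s.2.1 s.2.2 hR hT hsum
    fun d hd hd' => hcov d (by omega) hd

/-! ### Assembly -/

theorem lemma4p3 (v : ℕ) (hmod : v ≡ 5 [MOD 6]) (hv : 59 ≤ v) :
    ∃ F : Finset (Finset (ZMod v)), IsPDF v {3, 4, 5} F := by
  have hmod' : v % 6 = 5 := hmod
  obtain ⟨n, rfl⟩ : ∃ n, v = 2 * n + 1 := ⟨v / 2, by omega⟩
  by_cases hn : n ≤ 95
  · exact exists_isPDF_of_le (by omega) hn (by omega)
  -- Since n ≡ 2 mod 3, its residue mod 12 is 2, 5, 8 or 11; n ≥ 96 = 12 · 8 makes the subtraction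
  -- in the witness exact.
  obtain ⟨t, h | h | h | h⟩ : ∃ t, n = 12 * t + 96 + 2 ∨ n = 12 * t + 96 + 5 ∨
      n = 12 * t + 96 + 8 ∨ n = 12 * t + 96 + 11 := ⟨n / 12 - 8, by omega⟩
  · subst h
    exact exists_isPDF_of_residue_2 t
  · subst h
    exact exists_isPDF_of_residue_5 t
  · subst h
    exact exists_isPDF_of_residue_8 t
  · subst h
    exact exists_isPDF_of_residue_11 t
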